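/- Let $p$ be a prime, let $\mathbf K$ be a finite extension of $\mathbf Q_p$ with the absolute value extending $|\cdot|_p$, and let $\mathfrak o_{\mathbf K}=\{x\in\mathbf K : |x|\le 1\}$ be its valuation ring. Let $V$ be a smooth affine variety defined over $\mathfrak o_{\mathbf K}$, of dimension $m=\dim V$ (smoothness and dimension being those of the generic fibre $V_{\mathbf K}$). Endow $V(\mathfrak o_{\mathbf K})$ with the topology induced by any embedding of $V$ into an affine space $\mathbb A^N_{\mathfrak o_{\mathbf K}}$, and let $\mathsf{Aut}(V_{\mathfrak o_{\mathbf K}})$ be the group of automorphisms of $V$ over $\mathfrak o_{\mathbf K}$. A function on $\mathfrak o_{\mathbf K}^d$ is analytic if it is given on all of $\mathfrak o_{\mathbf K}^d$ by a power series whose coefficients in $\mathbf K$ tend to $0$. A polydisk of $V$ is an open subset $\mathcal U\subset V(\mathfrak o_{\mathbf K})$ which is the image of $\mathfrak o_{\mathbf K}^m$ by an analytic diffeomorphism. An analytic flow on $\mathcal U\simeq\mathfrak o_{\mathbf K}^m$ is an analytic map $\Phi\colon\mathfrak o_{\mathbf K}\times\mathcal U\to\mathcal U$ with $\Phi^{s+t}=\Phi^s\circ\Phi^t$.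 If $f\in\mathsf{Aut}(V_{\mathfrak o_{\mathbf K}})$ stabilizes $\mathcal U$ and $f|_{\mathcal U}=\Phi_f^1$ for such a flow $\Phi_f$, put $\Theta_f(x)=\partial_t\Phi_f^t(x)|_{t=0}\in T_xV$ for $x\in\mathcal U$. Let $\Gamma$ be a subgroup of $\mathsf{Aut}(V_{\mathfrak o_{\mathbf K}})$. For $x\in V(\mathfrak o_{\mathbf K})$, let $\mathcal U$ be a polydisk containing $x$ and $\Gamma_0\subset\Gamma$ a finite index subgroup which stabilizes $\mathcal U$ and each element of which is the time-one map of an analytic flow on $\mathcal U$; let $L_\Gamma(x)\subset T_xV$ be the $\mathbf Q_p$-linear span of the vectors $\Theta_f(x)$, $f\in\Gamma_0$ (it depends neither on $\mathcal U$ nor on $\Gamma_0$), and let $s_\Gamma(x)=\dim_{\mathbf Q_p}L_\Gamma(x)$. Theorem B. Let $B\subset V(\mathfrak o_{\mathbf K})$ be a compact $\Gamma$-invariant subset. If $s_\Gamma(x)=[\mathbf K:\mathbf Q_p]\dim(V)$ for every $x\in B$, then the closures $\overline{\Gamma(x)}$ of the orbits of the points $x\in B$ form a partition of $B$ into finitely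 many subsets, each of which is compact and is open in $V(\mathfrak o_{\mathbf K})$. -/

import Mathlib

open Filter Topology TensorProduct

namespace PadicOrbit

/-- The valuation ring `{x ∈ K ; |x| ≤ 1}` of a non-archimedean normed field. -/
noncomputable abbrev valRing (K : Type*) [NormedField K] [IsUltrametricDist K] : ValuationSubring K :=
  (NormedField.valuation (K := K)).valuationSubring

/-- Check of the definition: `valRing K` is the closed unit ball of `K`. -/
theorem mem_valRing {K : Type*} [NormedField K] [IsUltrametricDist K] (x : K) :
    x ∈ valRing K ↔ ‖x‖ ≤ 1 := by
  simp [Valuation.mem_valuationSubring_iff, NormedField.valuation_apply,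
    ← NNReal.coe_le_coe]

section Points

variable (K : Type*) [NormedField K] [IsUltrametricDist K]
variable (A : Type*) [CommRing A] [Algebra (valRing K) A]

/-- The set `V(𝔬_K)` of integral points of the affine scheme `V = Spec A`. -/
def Points : Type _ := A →ₐ[valRing K] valRing K

variable {K A}

/-- The value in `𝔬_K` of the regular function `a` at the point `x`. -/
noncomputable def Points.eval (x : Points K A) (a : A) : valRing K :=
  (show A →ₐ[valRing K] valRing K from x) a

/-- The coarsest topology for which all regular functions are continuous. If `a₁, …, a_N` generate
`A`, it is the topology induced by the embedding `x ↦ (a₁(x), …, a_N(x))` into `𝔬_K ^ N`. -/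
noncomputable instance : TopologicalSpace (Points K A) :=
  TopologicalSpace.induced (fun (x : Points K A) (a : A) => x.eval a) inferInstance

/-- The group `Aut(V)` is identified with the group of `𝔬_K`-algebra automorphisms of `A` by sending
`f` to the inverse of `f^*`; the automorphism `σ` sends the point `x` to `x ∘ σ⁻¹`. -/
noncomputable instance : MulAction (A ≃ₐ[valRing K] A) (Points K A) where
  smul σ x := (show A →ₐ[valRing K] valRing K from x).comp (σ.symm : A →ₐ[valRing K] A)
  one_smul _ := rfl
  mul_smul _ _ _ := rfl

variable (K A)

/-- The dimension of the variety `V`, that is, of its generic fibre `V_K`. (The value is `0` when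
`V_K` is empty, in which case there are no integral points.) -/
noncomputable def dim : ℕ := (WithBot.unbotD 0 (ringKrullDim (K ⊗[valRing K] A))).toNat

end Points

section Analytic

variable {K : Type*} [NormedField K] [IsUltrametricDist K]

/-- Tate analytic functions on the polydisk `𝔬_K ^ d`: functions given on the whole polydisk by a
power series whose coefficients tend to `0` as the multi-index tends to infinity. -/
def IsTate {d : ℕ} (g : (Fin d → valRing K) → K) : Prop :=
  ∃ c : (Fin d →₀ ℕ) → K, Tendsto c cofinite (𝓝 0) ∧
    ∀ z, HasSum (fun I => c I * ∏ i, (z i : K) ^ I i) (g z)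

/-- Analytic flows `(t, z) ↦ Ψ t z` on the polydisk `𝔬_K ^ d`, parametrized by `𝔬_K`. -/
structure IsFlow {d : ℕ} (Ψ : valRing K → (Fin d → valRing K) → (Fin d → valRing K)) : Prop where
  analytic : ∀ i, IsTate (fun w : Fin (d + 1) → valRing K => (Ψ (w 0) (Fin.tail w) i : K))
  add : ∀ s t z, Ψ (s + t) z = Ψ s (Ψ t z)

variable {A : Type*} [CommRing A] [Algebra (valRing K) A]

/-- A function `g` on `U ⊆ V(𝔬_K)` is locally analytic if, near each point `u` of `U`, it is a
convergent power series in finitely many functions `b j - b j (u)`, with `b j` regular.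
Here "near `u`" is the neighbourhood of all `v` such that `b j (v) ≡ b j (u)` modulo `ϖ`. -/
def IsLocallyAnalyticOn (U : Set (Points K A)) (g : Points K A → K) : Prop :=
  ∀ u ∈ U, ∃ (k : ℕ) (b : Fin k → A) (ϖ : valRing K) (F : (Fin k → valRing K) → K),
    ϖ ≠ 0 ∧ IsTate F ∧ ∀ v ∈ U, ∀ y : Fin k → valRing K,
      (∀ j, v.eval (b j) = u.eval (b j) + ϖ * y j) → g v = F y

/-- `φ` is an analytic diffeomorphism from the polydisk `𝔬_K ^ d` onto an open subset of `V(𝔬_K)`;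
its image `U = Set.range φ` is then called a polydisk of `V`. -/
structure IsPolydisk {d : ℕ} (φ : (Fin d → valRing K) → Points K A) : Prop where
  analytic : ∀ a : A, IsTate (fun z => ((φ z).eval a : K))
  isOpen_range : IsOpen (Set.range φ)
  analytic_inverse : ∃ ψ : Points K A → (Fin d → valRing K), Function.LeftInverse ψ φ ∧
    ∀ i, IsLocallyAnalyticOn (Set.range φ) (fun u => (ψ u i : K))

/-- Seen in the chart `φ`, the automorphism `f` is the time-one map of the analytic flow `Ψ`. -/
def IsFlowOf {d : ℕ} (φ : (Fin d → valRing K) → Points K A)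
    (Ψ : valRing K → (Fin d → valRing K) → (Fin d → valRing K)) (f : A ≃ₐ[valRing K] A) : Prop :=
  IsFlow Ψ ∧ ∀ z, φ (Ψ 1 z) = f • φ z

/-- The finite index subgroup `Γ₀` of `Γ` stabilizes the polydisk parametrized by `φ`, and each
element of `Γ₀` is the time-one map of an analytic flow on this polydisk. -/
structure IsGood (Γ Γ₀ : Subgroup (A ≃ₐ[valRing K] A)) {d : ℕ}
    (φ : (Fin d → valRing K) → Points K A) : Prop where
  le : Γ₀ ≤ Γ
  finiteIndex : (Γ₀.subgroupOf Γ).FiniteIndex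
  isPolydisk : IsPolydisk φ
  stable : ∀ f ∈ Γ₀, ∀ u ∈ Set.range φ, f • u ∈ Set.range φ
  exists_flow : ∀ f ∈ Γ₀, ∃ Ψ, IsFlowOf φ Ψ f

/-- The tangent space `T_x V`, that is, the `K`-vector space of all `K`-valued derivations of `A`
at the point `x`. -/
def tangentSpace (x : Points K A) : Submodule K (A → K) where
  carrier := {v | (∀ a b, v (a + b) = v a + v b) ∧
    (∀ (r : valRing K) (a : A), v (r • a) = (r : K) * v a) ∧
    ∀ a b, v (a * b) = (x.eval a : K) * v b + (x.eval b : K) * v a}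
  zero_mem' := by simp
  add_mem' := by
    rintro v w ⟨h1, h2, h3⟩ ⟨k1, k2, k3⟩
    refine ⟨fun a b => ?_, fun r a => ?_, fun a b => ?_⟩
    · simp only [Pi.add_apply, h1, k1]; ring
    · simp only [Pi.add_apply, h2, k2]; ring
    · simp only [Pi.add_apply, h3, k3]; ring
  smul_mem' := by
    rintro c v ⟨h1, h2, h3⟩
    refine ⟨fun a b => ?_, fun r a => ?_, fun a b => ?_⟩
    · simp only [Pi.smul_apply, smul_eq_mul, h1]; ring
    · simp only [Pi.smul_apply, smul_eq_mul, h2]; ring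
    · simp only [Pi.smul_apply, smul_eq_mul, h3]; ring

/-- `v = Θ_f(x)` is the velocity at `t = 0` of the curve `t ↦ Φ_f^t(x)`, where `Φ_f` is an analytic
flow with time-one map `f` on the polydisk parametrized by `φ`. -/
def IsFlowVector {d : ℕ} (φ : (Fin d → valRing K) → Points K A) (f : A ≃ₐ[valRing K] A)
    (x : Points K A) (v : tangentSpace x) : Prop :=
  ∃ Ψ, IsFlowOf φ Ψ f ∧ ∃ z, φ z = x ∧ ∀ a : A,
    Tendsto (fun t : valRing K =>
      (t : K)⁻¹ * (((φ (Ψ t z)).eval a : K) - ((φ (Ψ 0 z)).eval a : K))) (𝓝[≠] 0) (𝓝 (v.1 a))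

variable (p : ℕ) [Fact p.Prime] [NormedAlgebra ℚ_[p] K]

/-- `L_{Γ₀}(x)`, the `ℚ_p`-span of the vectors `Θ_f(x)` for `f` in `Γ₀`. -/
noncomputable def flowSpan (Γ₀ : Subgroup (A ≃ₐ[valRing K] A)) {d : ℕ}
    (φ : (Fin d → valRing K) → Points K A) (x : Points K A) :
    Submodule ℚ_[p] (tangentSpace x) :=
  Submodule.span ℚ_[p] {v | ∃ f ∈ Γ₀, IsFlowVector φ f x v}

/-- The tangent space `L_Γ(x)` to the action of `Γ` at `x`: the subspace `L_{Γ₀}(x)`, for any finite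
index subgroup `Γ₀` of `Γ` which stabilizes a polydisk containing `x` and all of whose elements are
in analytic flows on that polydisk. As `L_{Γ₀}(x)` does not depend on the choice of `Γ₀` and of the
polydisk, this common value is written here as a supremum. -/
noncomputable def tangentToAction (Γ : Subgroup (A ≃ₐ[valRing K] A)) (x : Points K A) :
    Submodule ℚ_[p] (tangentSpace x) :=
  ⨆ (Γ₀ : Subgroup (A ≃ₐ[valRing K] A)) (φ : (Fin (dim K A) → valRing K) → Points K A)
    (_ : IsGood Γ Γ₀ φ ∧ x ∈ Set.range φ), flowSpan p Γ₀ φ x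

/-- `s_Γ(x)`, the dimension of `L_Γ(x)` over `ℚ_p`. -/
noncomputable def flowDim (Γ : Subgroup (A ≃ₐ[valRing K] A)) (x : Points K A) : ℕ :=
  Module.finrank ℚ_[p] (tangentToAction p Γ x)

end Analytic

end PadicOrbit

/-!
The theorem is reduced to one statement: for `x ∈ B` the closure of the orbit `Γ x` is a
neighbourhood of `x` (`closure_orbit_mem_nhds`). Given this, two orbit closures which meet coincide,
so they are open, and compactness of `B` leaves finitely many (`closure_orbit_partition`).

In positive dimension, the hypothesis on `s_Γ(x)` provides a polydisk `φ : 𝔬_K ^ m → V(𝔬_K)` with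
`x = φ z`, and a finite index subgroup `Γ₀` whose elements are time-one maps of flows on it. A vector
`Θ_f(x)` is the limit of the difference quotients of `f ^ (N p ^ k)` as `k → ∞`, for any `N ≥ 1`, so
it only depends on the iterates of `f`. Since a power `f ^ N` of each element of another admissible
subgroup lies in `Γ₀`, the whole of `L_Γ(x)` is contained in the image under the derivative of `φ` of
the `ℚ_p`-span of the velocities `X ∈ K ^ m` at `z` of the flows in the chart `φ`
(`exists_map_tangentToAction_le`). Comparing dimensions, these velocities span `K ^ m` over `ℚ_p`.

Tate analytic functions are strictly differentiable over `ℚ_p`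
(`IsTate.exists_hasStrictFDerivAt`). Composing finitely many flows with spanning velocities
`X_1, …, X_r` gives a map `(t_1, …, t_r) ↦ Ψ_1^{t_1} ∘ ⋯ ∘ Ψ_r^{t_r} (z)` from `ℤ_p ^ r` whose
derivative `(t_i) ↦ ∑ t_i X_i` at `0` is surjective, so by the inverse function theorem its image is
a neighbourhood of `z` (`map_compFlow_nhds`). As `ℕ` is dense in `ℤ_p` and `Ψ_i^n` is the iterate
`f_i ^ n` for `n ∈ ℕ`, this image lies in the closure of the orbit
(`IsFlowOf.apply_mem_closure_orbit`). In dimension `0` there are only finitely many integral points,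
and nothing more is needed (`finite_points_of_dim_eq_zero`).
-/

namespace PadicOrbit

/-! ### Tate analytic functions are strictly differentiable over `ℚ_p` -/

section Monomials

variable {K : Type*} [NormedField K] [IsUltrametricDist K]

theorem norm_mul_sub_mul_le {a a' b b' : K} {δ : ℝ} (ha : ‖a‖ ≤ 1) (hb' : ‖b'‖ ≤ 1)
    (haa' : ‖a - a'‖ ≤ δ) (hbb' : ‖b - b'‖ ≤ δ) : ‖a * b - a' * b'‖ ≤ δ := by
  have h : a * b - a' * b' = a * (b - b') + (a - a') * b' := by ring
  rw [h]
  refine (IsUltrametricDist.norm_add_le_max _ _).trans (max_le ?_ ?_)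
  · rw [norm_mul]
    exact (mul_le_of_le_one_left (norm_nonneg _) ha).trans hbb'
  · rw [norm_mul]
    exact (mul_le_of_le_one_right (norm_nonneg _) hb').trans haa'

theorem norm_pow_sub_pow_le {a b : K} (ha : ‖a‖ ≤ 1) (hb : ‖b‖ ≤ 1) (n : ℕ) :
    ‖a ^ n - b ^ n‖ ≤ ‖a - b‖ := by
  induction n with
  | zero => simp
  | succ n ih =>
    rw [pow_succ, pow_succ]
    exact norm_mul_sub_mul_le (by rw [norm_pow]; exact pow_le_one₀ (norm_nonneg _) ha) hb ih le_rfl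

/-- Monomials are `1`-Lipschitz on the unit polydisk, whatever their degree: this is where the
ultrametric inequality makes `p`-adic power series behave well. -/
theorem norm_prod_pow_sub_prod_pow_le {d : ℕ} {x y : Fin d → K} (hx : ‖x‖ ≤ 1) (hy : ‖y‖ ≤ 1)
    (I : Fin d → ℕ) (s : Finset (Fin d)) :
    ‖∏ i ∈ s, x i ^ I i - ∏ i ∈ s, y i ^ I i‖ ≤ ‖x - y‖ := by
  have hx' := (pi_norm_le_iff_of_nonneg zero_le_one).1 hx
  have hy' := (pi_norm_le_iff_of_nonneg zero_le_one).1 hy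
  classical
  induction s using Finset.induction_on with
  | empty => simp
  | insert j s hj ih =>
    rw [Finset.prod_insert hj, Finset.prod_insert hj]
    refine norm_mul_sub_mul_le ?_ ?_ ?_ ih
    · rw [norm_pow]; exact pow_le_one₀ (norm_nonneg _) (hx' j)
    · rw [norm_prod]
      refine Finset.prod_le_one (fun _ _ => norm_nonneg _) fun i _ => ?_
      rw [norm_pow]; exact pow_le_one₀ (norm_nonneg _) (hy' i)
    · exact (norm_pow_sub_pow_le (hx' j) (hy' j) _).trans (norm_le_pi_norm (x - y) j)

theorem norm_le_of_hasSum {ι : Type*} {f : ι → K} {a : K} {C : ℝ} (hf : HasSum f a) (hC : 0 ≤ C)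
    (h : ∀ i, ‖f i‖ ≤ C) : ‖a‖ ≤ C :=
  hf.tsum_eq ▸ IsUltrametricDist.norm_tsum_le_of_forall_le_of_nonneg hC h

/-- The inclusion of the integral polydisk `𝔬_K ^ d` into `K ^ d`. -/
def toVec {d : ℕ} (z : Fin d → valRing K) : Fin d → K := fun i => z i

theorem norm_toVec_le {d : ℕ} (z : Fin d → valRing K) : ‖toVec z‖ ≤ 1 :=
  (pi_norm_le_iff_of_nonneg zero_le_one).2 fun i => (mem_valRing _).1 (z i).2

theorem exists_toVec_eq {d : ℕ} {w : Fin d → K} (hw : ‖w‖ ≤ 1) :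
    ∃ z : Fin d → valRing K, toVec z = w :=
  ⟨fun i => ⟨w i, (mem_valRing _).2 ((norm_le_pi_norm w i).trans hw)⟩, rfl⟩

theorem toVec_injective {d : ℕ} :
    Function.Injective (toVec : (Fin d → valRing K) → Fin d → K) :=
  fun _ _ h => funext fun i => Subtype.ext (congrFun h i)

theorem isEmbedding_toVec {d : ℕ} :
    IsEmbedding (toVec : (Fin d → valRing K) → Fin d → K) :=
  IsEmbedding.piMap fun _ => IsEmbedding.subtypeVal

theorem eventually_norm_le_one {E : Type*} [SeminormedAddCommGroup E] [IsUltrametricDist E]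
    {w : E} (hw : ‖w‖ ≤ 1) : ∀ᶠ x in 𝓝 w, ‖x‖ ≤ 1 := by
  filter_upwards [Metric.ball_mem_nhds w one_pos] with x hx
  rw [← sub_add_cancel x w]
  exact (IsUltrametricDist.norm_add_le_max _ _).trans (max_le (mem_ball_iff_norm.1 hx).le hw)

end Monomials

section Differentiability

variable (p : ℕ) [Fact p.Prime]
variable {K : Type*} [NormedField K] [IsUltrametricDist K] [NormedAlgebra ℚ_[p] K]

theorem exists_hasStrictFDerivAt_monomial {d : ℕ} {w : Fin d → K} (hw : ‖w‖ ≤ 1)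
    (I : Fin d → ℕ) : ∃ L : (Fin d → K) →L[ℚ_[p]] K, ‖L‖ ≤ 1 ∧
      HasStrictFDerivAt (fun x : Fin d → K => ∏ i, x i ^ I i) L w := by
  obtain ⟨L, hL⟩ : ∃ L : (Fin d → K) →L[ℚ_[p]] K,
      HasStrictFDerivAt (fun x : Fin d → K => ∏ i, x i ^ I i) L w :=
    ⟨_, HasStrictFDerivAt.finsetProd (u := Finset.univ) fun i _ =>
      (hasStrictFDerivAt_apply (𝕜 := ℚ_[p]) i w).pow (I i)⟩
  refine ⟨L, hL.hasFDerivAt.le_of_lip' zero_le_one ?_, hL⟩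
  filter_upwards [eventually_norm_le_one hw] with x hx
  rw [one_mul]
  exact norm_prod_pow_sub_prod_pow_le hx hw I _

variable [CompleteSpace K]

/-- Tate analytic functions are strictly differentiable over `ℚ_p`, hence subject to the inverse
function theorem. The derivative is obtained by differentiating termwise: all but finitely many
terms are `ε`-Lipschitz, so only the differentiability of polynomials is used. -/
theorem IsTate.exists_hasStrictFDerivAt {d : ℕ} {g : (Fin d → valRing K) → K} (hg : IsTate g)
    {G : (Fin d → K) → K} (hG : ∀ z, G (toVec z) = g z) (z : Fin d → valRing K) :
    ∃ L : (Fin d → K) →L[ℚ_[p]] K, HasStrictFDerivAt G L (toVec z) := by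
  obtain ⟨c, hc, hsum⟩ := hg
  have hw := norm_toVec_le z
  choose M hM1 hM using fun I : Fin d →₀ ℕ => exists_hasStrictFDerivAt_monomial p hw I
  have hMle (I v) : ‖M I v‖ ≤ ‖v‖ := by
    simpa using (M I).le_of_opNorm_le (hM1 I) v
  have hMsum (v : Fin d → K) : Summable fun I => c I * M I v := by
    refine NonarchimedeanAddGroup.summable_of_tendsto_cofinite_zero ?_
    refine squeeze_zero_norm (a := fun I => ‖c I‖ * ‖v‖) (fun I => ?_) ?_
    · rw [norm_mul]
      exact mul_le_mul_of_nonneg_left (hMle I v) (norm_nonneg _)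
    · simpa using hc.norm.mul_const ‖v‖
  obtain ⟨C, hC⟩ : ∃ C, ∀ I, ‖c I‖ ≤ C := by
    obtain ⟨C, hC⟩ := (hc.norm.isBoundedUnder_le).bddAbove_range_of_cofinite
    exact ⟨C, fun I => hC ⟨I, rfl⟩⟩
  have hC0 : 0 ≤ C := (norm_nonneg _).trans (hC 0)
  let L₀ : (Fin d → K) →ₗ[ℚ_[p]] K :=
    { toFun v := ∑' I, c I * M I v
      map_add' v w := by
        rw [← (hMsum v).tsum_add (hMsum w)]
        simp [mul_add]
      map_smul' r v := by
        rw [RingHom.id_apply, ← (hMsum v).tsum_const_smul]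
        simp }
  let L : (Fin d → K) →L[ℚ_[p]] K := L₀.mkContinuous C fun v =>
    norm_le_of_hasSum (hMsum v).hasSum (by positivity) fun I => by
      rw [norm_mul]
      exact mul_le_mul (hC I) (hMle I v) (norm_nonneg _) hC0
  have hL (v) : HasSum (fun I => c I * M I v) (L v) := (hMsum v).hasSum
  refine ⟨L, .of_isLittleO (Asymptotics.isLittleO_iff.2 fun ε hε => ?_)⟩
  have hfin : {I | ¬ ‖c I‖ ≤ ε}.Finite := by
    have := (tendsto_zero_iff_norm_tendsto_zero.1 hc).eventually (ge_mem_nhds hε)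
    simpa [Filter.Eventually, mem_cofinite, Set.compl_ofPred] using this
  have hev : ∀ᶠ q : (Fin d → K) × (Fin d → K) in 𝓝 (toVec z, toVec z),
      ∀ I ∈ hfin.toFinset, ‖(∏ i, q.1 i ^ I i - ∏ i, q.2 i ^ I i) - M I (q.1 - q.2)‖ ≤
        ε / (C + 1) * ‖q.1 - q.2‖ := by
    rw [Filter.eventually_all_finset]
    intro I _
    exact Asymptotics.isLittleO_iff.1 (hM I).isLittleO (by positivity)
  have hball : ∀ᶠ q : (Fin d → K) × (Fin d → K) in 𝓝 (toVec z, toVec z),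
      ‖q.1‖ ≤ 1 ∧ ‖q.2‖ ≤ 1 :=
    (continuous_fst.continuousAt.eventually (eventually_norm_le_one hw)).and
      (continuous_snd.continuousAt.eventually (eventually_norm_le_one hw))
  filter_upwards [hev, hball] with q hq hq1
  have hval (w : Fin d → K) (hw : ‖w‖ ≤ 1) : HasSum (fun I => c I * ∏ i, w i ^ I i) (G w) := by
    obtain ⟨y, rfl⟩ := exists_toVec_eq hw
    rw [hG]
    exact hsum y
  refine norm_le_of_hasSum (((hval _ hq1.1).sub (hval _ hq1.2)).sub (hL (q.1 - q.2)))
    (by positivity) fun I => ?_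
  rw [← mul_sub, ← mul_sub, norm_mul]
  by_cases hI : ‖c I‖ ≤ ε
  · refine mul_le_mul hI ?_ (norm_nonneg _) hε.le
    rw [sub_eq_add_neg]
    refine (IsUltrametricDist.norm_add_le_max _ _).trans
      (max_le ?_ (by rw [norm_neg]; exact hMle I _))
    exact norm_prod_pow_sub_prod_pow_le hq1.1 hq1.2 I _
  · calc ‖c I‖ * _ ≤ (C + 1) * (ε / (C + 1) * ‖q.1 - q.2‖) :=
        mul_le_mul ((hC I).trans (by linarith)) (hq I (by simpa using hI)) (norm_nonneg _)
          (by positivity)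
      _ = ε * ‖q.1 - q.2‖ := by field_simp

end Differentiability

/-! ### Orbit closures, and the topology of the set of integral points -/

section OrbitClosures

variable {G X : Type*} [Group G] [TopologicalSpace X] [MulAction G X] [ContinuousConstSMul G X]

theorem smul_mem_closure_orbit (g : G) {x y : X} (hy : y ∈ closure (MulAction.orbit G x)) :
    g • y ∈ closure (MulAction.orbit G x) := by
  refine map_mem_closure (continuous_const_smul g) hy ?_
  rintro _ ⟨h, rfl⟩
  exact ⟨g * h, mul_smul g h x⟩

theorem closure_orbit_subset {x y : X} (hy : y ∈ closure (MulAction.orbit G x)) :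
    closure (MulAction.orbit G y) ⊆ closure (MulAction.orbit G x) := by
  refine closure_minimal ?_ isClosed_closure
  rintro _ ⟨g, rfl⟩
  exact smul_mem_closure_orbit g hy

theorem closure_orbit_eq_of_mem {x y : X} (h : closure (MulAction.orbit G y) ∈ 𝓝 y)
    (hy : y ∈ closure (MulAction.orbit G x)) :
    closure (MulAction.orbit G y) = closure (MulAction.orbit G x) := by
  refine (closure_orbit_subset hy).antisymm ?_
  obtain ⟨_, h', g, rfl⟩ := mem_closure_iff_nhds.1 hy _ h
  refine closure_orbit_subset ?_
  simpa using smul_mem_closure_orbit g⁻¹ h'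

/-- If the orbit closure of each point of an invariant compact set is a neighbourhood of that point,
then these orbit closures partition the compact set into finitely many compact open pieces. -/
theorem closure_orbit_partition [T2Space X] {B : Set X} (hB : IsCompact B)
    (hGB : ∀ (g : G), ∀ x ∈ B, g • x ∈ B)
    (h : ∀ x ∈ B, closure (MulAction.orbit G x) ∈ 𝓝 x) :
    {C | ∃ x ∈ B, C = closure (MulAction.orbit G x)}.Finite ∧
      {C | ∃ x ∈ B, C = closure (MulAction.orbit G x)}.PairwiseDisjoint id ∧
      ⋃₀ {C | ∃ x ∈ B, C = closure (MulAction.orbit G x)} = B ∧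
      ∀ x ∈ B, IsCompact (closure (MulAction.orbit G x)) ∧
        IsOpen (closure (MulAction.orbit G x)) := by
  have hsub : ∀ x ∈ B, closure (MulAction.orbit G x) ⊆ B := fun x hx =>
    closure_minimal (by rintro _ ⟨g, rfl⟩; exact hGB g x hx) hB.isClosed
  have heq : ∀ x ∈ B, ∀ y ∈ closure (MulAction.orbit G x),
      closure (MulAction.orbit G y) = closure (MulAction.orbit G x) := fun x hx y hy =>
    closure_orbit_eq_of_mem (h y (hsub x hx hy)) hy
  refine ⟨?_, ?_, ?_, fun x hx => ⟨hB.of_isClosed_subset isClosed_closure (hsub x hx), ?_⟩⟩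
  · obtain ⟨t, ht, hBt⟩ := hB.elim_nhds_subcover _ h
    refine (t.finite_toSet.image fun x => closure (MulAction.orbit G x)).subset ?_
    rintro _ ⟨y, hy, rfl⟩
    obtain ⟨x, hx, hyx⟩ := Set.mem_iUnion₂.1 (hBt hy)
    exact ⟨x, hx, (heq x (ht x hx) y hyx).symm⟩
  · rintro _ ⟨x, hx, rfl⟩ _ ⟨y, hy, rfl⟩ hne
    refine Set.disjoint_left.2 fun w hwx hwy => hne ?_
    exact (heq x hx w hwx).symm.trans (heq y hy w hwy)
  · refine Set.Subset.antisymm ?_ fun x hx =>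
      ⟨_, ⟨x, hx, rfl⟩, subset_closure (MulAction.mem_orbit_self x)⟩
    rintro y ⟨_, ⟨x, hx, rfl⟩, hy⟩
    exact hsub x hx hy
  · refine isOpen_iff_mem_nhds.2 fun y hy => ?_
    rw [← heq x hx y hy]
    exact h y (hsub x hx hy)

end OrbitClosures

section PointsTopology

variable {K : Type*} [NormedField K] [IsUltrametricDist K]
variable {A : Type*} [CommRing A] [Algebra (valRing K) A]

theorem Points.eval_injective :
    Function.Injective (fun (x : Points K A) (a : A) => x.eval a) :=
  fun _ _ h => AlgHom.ext fun a => congrFun h a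

theorem Points.isEmbedding_eval :
    IsEmbedding (fun (x : Points K A) (a : A) => x.eval a) :=
  ⟨⟨rfl⟩, Points.eval_injective⟩

theorem Points.continuous_eval (a : A) : Continuous fun x : Points K A => x.eval a :=
  (continuous_apply a).comp Points.isEmbedding_eval.continuous

instance : T2Space (Points K A) := Points.isEmbedding_eval.t2Space

instance : ContinuousConstSMul (A ≃ₐ[valRing K] A) (Points K A) where
  continuous_const_smul σ := by
    refine Points.isEmbedding_eval.continuous_iff.2 (continuous_pi fun a => ?_)
    exact Points.continuous_eval (σ.symm a)

instance (Γ : Subgroup (A ≃ₐ[valRing K] A)) : ContinuousConstSMul Γ (Points K A) where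
  continuous_const_smul g := continuous_const_smul (g : A ≃ₐ[valRing K] A)

variable (K A) in
/-- In dimension zero the generic fibre is the spectrum of an Artinian ring, so it has finitely many
points. -/
theorem finite_points_of_dim_eq_zero [Algebra.FiniteType (valRing K) A] (h : dim K A = 0) :
    Finite (Points K A) := by
  let R := K ⊗[valRing K] A
  have : IsNoetherianRing R := Algebra.FiniteType.isNoetherianRing K R
  -- Krull dimension `⊤` would also give `dim K A = 0`, but it does not occur.
  have htop : ringKrullDim R ≠ ⊤ := by
    obtain ⟨n, f, hf⟩ := Algebra.FiniteType.iff_quotient_mvPolynomial''.1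
      (inferInstance : Algebra.FiniteType K R)
    have := ringKrullDim_le_of_surjective f.toRingHom hf
    rw [MvPolynomial.ringKrullDim_of_isNoetherianRing, ringKrullDim_eq_zero_of_field] at this
    intro h'
    rw [h', zero_add, top_le_iff] at this
    exact absurd this (by simpa using (WithBot.coe_injective.ne (ENat.natCast_ne_top n)))
  have hle : ringKrullDim R ≤ 0 := by
    change (WithBot.unbotD 0 (ringKrullDim R)).toNat = 0 at h
    generalize ringKrullDim R = r at h htop
    induction r using WithBot.recBotCoe with
    | bot => exact bot_le
    | coe r =>
      induction r using ENat.recTopCoe with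
      | top => exact absurd rfl htop
      | coe r =>
        simp only [WithBot.unbotD_coe, ENat.toNat_natCast] at h
        subst h
        rfl
  have hdim : Ring.KrullDimLE 0 R := by
    rw [Ring.krullDimLE_iff]
    simpa using hle
  let Q (x : Points K A) : R →ₐ[K] K :=
    Algebra.TensorProduct.lift (Algebra.ofId K K)
      ((Algebra.ofId (valRing K) K).comp (show A →ₐ[valRing K] valRing K from x))
      fun _ _ => .all _ _
  have hQ (x a) : Q x (1 ⊗ₜ a) = x.eval a := by
    refine (Algebra.TensorProduct.lift_tmul _ _ _ _ _).trans ?_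
    rw [map_one, one_mul]
    rfl
  have hfin : Finite (minimalPrimes R) := minimalPrimes.finite_of_isNoetherianRing R
  refine Finite.of_injective (β := minimalPrimes R) (fun x => ⟨RingHom.ker (Q x), ?_⟩) ?_
  · have := RingHom.ker_isPrime (Q x)
    exact Ideal.mem_minimalPrimes_of_krullDimLE_zero _
  · intro x y hxy
    refine Points.eval_injective (funext fun a => Subtype.ext ?_)
    have hker : RingHom.ker (Q x) = RingHom.ker (Q y) := congrArg Subtype.val hxy
    have hmem : (1 ⊗ₜ a - algebraMap K R (x.eval a)) ∈ RingHom.ker (Q x) := by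
      simp [RingHom.mem_ker, hQ]
    rw [hker, RingHom.mem_ker, map_sub, hQ, AlgHom.commutes, sub_eq_zero] at hmem
    exact hmem.symm

end PointsTopology

/-! ### Analytic flows and their compositions -/

section Flows

variable {K : Type*} [NormedField K] [IsUltrametricDist K]

/-- The extension to `K × K ^ d` of a flow on `𝔬_K ^ d`, with the value `0` outside the unit
polydisk. -/
noncomputable def flowExt {d : ℕ} (Ψ : valRing K → (Fin d → valRing K) → (Fin d → valRing K)) :
    K × (Fin d → K) → (Fin d → K) :=
  Function.extend (fun q : valRing K × (Fin d → valRing K) => ((q.1 : K), toVec q.2))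
    (fun q => toVec (Ψ q.1 q.2)) 0

theorem flowExt_apply {d : ℕ} (Ψ : valRing K → (Fin d → valRing K) → (Fin d → valRing K))
    (t : valRing K) (z : Fin d → valRing K) :
    flowExt Ψ ((t : K), toVec z) = toVec (Ψ t z) := by
  refine Function.Injective.extend_apply (f := fun q : valRing K × (Fin d → valRing K) =>
    ((q.1 : K), toVec q.2)) ?_ _ _ (t, z)
  rintro ⟨s, y⟩ ⟨s', y'⟩ h
  simp only [Prod.mk.injEq] at h
  exact Prod.ext (Subtype.ext h.1) (toVec_injective h.2)

variable (p : ℕ) [Fact p.Prime] [NormedAlgebra ℚ_[p] K]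

theorem IsFlow.exists_hasStrictFDerivAt_flowExt [CompleteSpace K] {d : ℕ}
    {Ψ : valRing K → (Fin d → valRing K) → (Fin d → valRing K)} (hΨ : IsFlow Ψ)
    (t : valRing K) (z : Fin d → valRing K) :
    ∃ L : K × (Fin d → K) →L[ℚ_[p]] (Fin d → K),
      HasStrictFDerivAt (flowExt Ψ) L ((t : K), toVec z) := by
  have h (i : Fin d) := (hΨ.analytic i).exists_hasStrictFDerivAt p
    (G := fun w => flowExt Ψ (w 0, Fin.tail w) i)
    (fun w => congrFun (flowExt_apply Ψ (w 0) (Fin.tail w)) i) (Fin.cons t z)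
  choose L hL using h
  let C : K × (Fin d → K) →L[ℚ_[p]] (Fin (d + 1) → K) :=
    ContinuousLinearMap.pi (Fin.cons (.fst ℚ_[p] K (Fin d → K))
      fun i => (ContinuousLinearMap.proj i).comp (.snd ℚ_[p] K (Fin d → K)))
  have hC : C ((t : K), toVec z) = toVec (Fin.cons t z : Fin (d + 1) → valRing K) :=
    funext fun j => Fin.cases rfl (fun _ => rfl) j
  have h (i : Fin d) :
      HasStrictFDerivAt (fun q => flowExt Ψ q i) ((L i).comp C) ((t : K), toVec z) := by
    have hi := hL i
    rw [← hC] at hi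
    exact hi.comp ((t : K), toVec z) C.hasStrictFDerivAt
  exact ⟨_, hasStrictFDerivAt_pi.2 h⟩

theorem IsFlow.continuous (p : ℕ) [Fact p.Prime] [NormedAlgebra ℚ_[p] K] [CompleteSpace K]
    {d : ℕ}
    {Ψ : valRing K → (Fin d → valRing K) → (Fin d → valRing K)} (hΨ : IsFlow Ψ)
    (z : Fin d → valRing K) : Continuous fun t => Ψ t z := by
  refine isEmbedding_toVec.continuous_iff.2 (continuous_iff_continuousAt.2 fun t => ?_)
  obtain ⟨L, hL⟩ := hΨ.exists_hasStrictFDerivAt_flowExt p t z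
  refine (hL.continuousAt.comp (f := fun s : valRing K => ((s : K), toVec z))
    (continuous_subtype_val.prodMk continuous_const).continuousAt).congr ?_
  exact .of_forall fun s => flowExt_apply Ψ s z

/-- `X` is the velocity `∂_t Ψ^t(z)` of the flow at `t = 0`. As `Ψ^0` is the identity, it determines
the whole derivative of `(t, w) ↦ Ψ^t(w)` at `(0, z)`. Time is restricted to `ℚ_p`, because the
differential calculus takes place over `ℚ_p`. -/
def HasVelocity {d : ℕ} (Ψ : valRing K → (Fin d → valRing K) → (Fin d → valRing K))
    (z : Fin d → valRing K) (X : Fin d → K) : Prop :=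
  HasStrictFDerivAt (fun q : ℚ_[p] × (Fin d → K) => flowExt Ψ (algebraMap ℚ_[p] K q.1, q.2))
    ((ContinuousLinearMap.fst ℚ_[p] ℚ_[p] (Fin d → K)).smulRight X +
      .snd ℚ_[p] ℚ_[p] (Fin d → K)) (0, toVec z)

theorem IsFlow.exists_hasVelocity [CompleteSpace K] {d : ℕ}
    {Ψ : valRing K → (Fin d → valRing K) → (Fin d → valRing K)} (hΨ : IsFlow Ψ)
    (h0 : ∀ z, Ψ 0 z = z) (z : Fin d → valRing K) : ∃ X, HasVelocity p Ψ z X := by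
  obtain ⟨L, hL⟩ := hΨ.exists_hasStrictFDerivAt_flowExt p 0 z
  have hsnd (v : Fin d → K) : L (0, v) = v := by
    have h1 : HasFDerivAt (fun w => flowExt Ψ ((0 : valRing K) , w))
        (L.comp (.inr ℚ_[p] K (Fin d → K))) (toVec z) :=
      hL.hasFDerivAt.comp (toVec z) (hasFDerivAt_prodMk_right _ _)
    have h2 : HasFDerivAt (fun w => flowExt Ψ ((0 : valRing K) , w))
        (.id ℚ_[p] (Fin d → K)) (toVec z) := by
      refine (hasFDerivAt_id _).congr_of_eventuallyEq ?_
      filter_upwards [eventually_norm_le_one (norm_toVec_le z)] with w hw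
      obtain ⟨y, rfl⟩ := exists_toVec_eq hw
      rw [flowExt_apply, h0, id]
    exact DFunLike.congr_fun (h1.unique h2) v
  let ι : ℚ_[p] × (Fin d → K) →L[ℚ_[p]] K × (Fin d → K) :=
    (Algebra.linearMap ℚ_[p] K).toContinuousLinearMap.prodMap (.id _ _)
  refine ⟨L (1, 0), ?_⟩
  have h : HasStrictFDerivAt (fun q : ℚ_[p] × (Fin d → K) => flowExt Ψ (ι q)) (L.comp ι)
      (0, toVec z) := by
    refine HasStrictFDerivAt.comp (0, toVec z) ?_ ι.hasStrictFDerivAt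
    have hι : ι (0, toVec z) = (((0 : valRing K) : K), toVec z) :=
      Prod.ext (map_zero (algebraMap ℚ_[p] K)) rfl
    rwa [hι]
  refine h.congr_fderiv (ContinuousLinearMap.ext fun q => ?_)
  have hq : ι q = q.1 • (1, 0) + (0, q.2) := by
    have : ι q = (algebraMap ℚ_[p] K q.1, q.2) := rfl
    simp [this, Algebra.smul_def]
  rw [ContinuousLinearMap.comp_apply, hq, map_add, map_smul, hsnd]
  rfl

/-- The composite `(t_i) ↦ Ψ_{i₁}^{t_{i₁}} ∘ ⋯ ∘ Ψ_{iₖ}^{t_{iₖ}} (z)` of flows along the list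
`i₁, …, iₖ`, in the extended sense of `flowExt`. -/
noncomputable def compFlow {d : ℕ} {ι : Type*}
    (Ψ : ι → valRing K → (Fin d → valRing K) → (Fin d → valRing K)) (z : Fin d → valRing K) :
    List ι → (ι → ℚ_[p]) → (Fin d → K)
  | [], _ => toVec z
  | i :: l, t => flowExt (Ψ i) (algebraMap ℚ_[p] K (t i), compFlow Ψ z l t)

theorem compFlow_zero {d : ℕ} {ι : Type*}
    {Ψ : ι → valRing K → (Fin d → valRing K) → (Fin d → valRing K)} {z : Fin d → valRing K}
    (h0 : ∀ i, Ψ i 0 z = z) (l : List ι) : compFlow p Ψ z l 0 = toVec z := by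
  induction l with
  | nil => rfl
  | cons i l ih =>
    rw [compFlow, ih, Pi.zero_apply, map_zero, ← ZeroMemClass.coe_zero (valRing K), flowExt_apply,
      h0]

/-- The velocities of composed flows add up. -/
theorem hasStrictFDerivAt_compFlow {d : ℕ} {ι : Type*} [Fintype ι]
    {Ψ : ι → valRing K → (Fin d → valRing K) → (Fin d → valRing K)} {z : Fin d → valRing K}
    (h0 : ∀ i, Ψ i 0 z = z) {X : ι → Fin d → K} (hX : ∀ i, HasVelocity p (Ψ i) z (X i))
    (l : List ι) :
    HasStrictFDerivAt (compFlow p Ψ z l)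
      (l.map fun i => (ContinuousLinearMap.proj (R := ℚ_[p]) (φ := fun _ : ι => ℚ_[p]) i).smulRight
        (X i)).sum 0 := by
  induction l with
  | nil => exact hasStrictFDerivAt_const _ _
  | cons i l ih =>
    have h := hX i
    rw [HasVelocity, ← compFlow_zero p h0 l] at h
    exact h.comp (f := fun t : ι → ℚ_[p] => (t i, compFlow p Ψ z l t)) 0
      ((hasStrictFDerivAt_apply i 0).prodMk ih)

/-- Inverse function theorem: if the velocities at `z` span `K ^ d` over `ℚ_p`, then composing the
flows for small times in `ℚ_p` reaches a whole neighbourhood of `z`. -/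
theorem map_compFlow_nhds [FiniteDimensional ℚ_[p] K] {d : ℕ} {ι : Type*} [Fintype ι]
    {Ψ : ι → valRing K → (Fin d → valRing K) → (Fin d → valRing K)} {z : Fin d → valRing K}
    (h0 : ∀ i, Ψ i 0 z = z) {X : ι → Fin d → K} (hX : ∀ i, HasVelocity p (Ψ i) z (X i))
    (hspan : Submodule.span ℚ_[p] (Set.range X) = ⊤) :
    map (compFlow p Ψ z Finset.univ.toList) (𝓝 0) = 𝓝 (toVec z) := by
  have : CompleteSpace K := FiniteDimensional.complete ℚ_[p] K
  rw [← compFlow_zero p h0 Finset.univ.toList]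
  refine (hasStrictFDerivAt_compFlow p h0 hX _).map_nhds_eq_of_surj ?_
  rw [eq_top_iff, ← hspan, Submodule.span_le]
  rintro _ ⟨i, rfl⟩
  classical
  refine ⟨Pi.single i 1, ?_⟩
  rw [Finset.sum_map_toList]
  simp [Pi.single_apply]

end Flows

/-! ### Flows in a polydisk and orbit closures -/

section Polydisks

variable {K : Type*} [NormedField K] [IsUltrametricDist K]
variable {A : Type*} [CommRing A] [Algebra (valRing K) A]
variable {d : ℕ} {φ : (Fin d → valRing K) → Points K A}

theorem IsPolydisk.injective (hφ : IsPolydisk φ) : Function.Injective φ :=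
  let ⟨_, hψ, _⟩ := hφ.analytic_inverse
  hψ.injective

theorem IsFlowOf.apply_natCast {Ψ : valRing K → (Fin d → valRing K) → (Fin d → valRing K)}
    {f : A ≃ₐ[valRing K] A} (h : IsFlowOf φ Ψ f) (n : ℕ)
    (z : Fin d → valRing K) : φ (Ψ n z) = f ^ n • φ z := by
  induction n with
  | zero =>
    rw [pow_zero, one_smul, Nat.cast_zero]
    -- `Ψ 1` is injective and `Ψ 1 = Ψ 1 ∘ Ψ 0`.
    refine smul_left_cancel f ?_
    rw [← h.2, ← h.1.add, add_zero, h.2]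
  | succ n ih => rw [Nat.cast_succ, add_comm, h.1.add, h.2, ih, pow_succ', mul_smul]

theorem IsFlowOf.apply_zero {Ψ : valRing K → (Fin d → valRing K) → (Fin d → valRing K)}
    {f : A ≃ₐ[valRing K] A} (hφ : IsPolydisk φ) (h : IsFlowOf φ Ψ f) (z : Fin d → valRing K) :
    Ψ 0 z = z :=
  hφ.injective (by simpa using h.apply_natCast 0 z)

variable (p : ℕ) [Fact p.Prime] [NormedAlgebra ℚ_[p] K]

theorem IsPolydisk.isOpenEmbedding [FiniteDimensional ℚ_[p] K] (hφ : IsPolydisk φ) :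
    IsOpenEmbedding φ := by
  have : CompleteSpace K := FiniteDimensional.complete ℚ_[p] K
  have : ProperSpace K := FiniteDimensional.proper ℚ_[p] K
  have : CompactSpace (valRing K) := by
    refine isCompact_iff_compactSpace.1 ?_
    convert isCompact_closedBall (0 : K) 1
    ext x
    exact (mem_valRing x).trans mem_closedBall_zero_iff.symm
  have hcont : Continuous φ := by
    refine Points.isEmbedding_eval.continuous_iff.2 (continuous_pi fun a => ?_)
    refine IsEmbedding.subtypeVal.continuous_iff.2 (continuous_iff_continuousAt.2 fun z => ?_)
    obtain ⟨L, hL⟩ := (hφ.analytic a).exists_hasStrictFDerivAt p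
      (G := Function.extend toVec _ 0) (toVec_injective.extend_apply _ _) z
    refine (hL.continuousAt.comp isEmbedding_toVec.continuous.continuousAt).congr ?_
    exact .of_forall (toVec_injective.extend_apply _ _)
  exact ⟨(hcont.isClosedEmbedding hφ.injective).isEmbedding, hφ.isOpen_range⟩

/-- The integers are dense in `ℤ_p`, so the flow of `f` for times in `ℤ_p` does not leave the
closure of an orbit of a group containing `f`. -/
theorem IsFlowOf.apply_mem_closure_orbit [FiniteDimensional ℚ_[p] K]
    {Γ : Subgroup (A ≃ₐ[valRing K] A)}
    {Ψ : valRing K → (Fin d → valRing K) → (Fin d → valRing K)} {f : A ≃ₐ[valRing K] A}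
    (hφ : IsPolydisk φ) (h : IsFlowOf φ Ψ f) (hf : f ∈ Γ) {x : Points K A}
    {y : Fin d → valRing K} (hy : φ y ∈ closure (MulAction.orbit Γ x))
    {t : ℚ_[p]} (ht : ‖t‖ ≤ 1) {s : valRing K} (hs : (s : K) = algebraMap ℚ_[p] K t) :
    φ (Ψ s y) ∈ closure (MulAction.orbit Γ x) := by
  have : CompleteSpace K := FiniteDimensional.complete ℚ_[p] K
  let j (r : ℤ_[p]) : valRing K :=
    ⟨algebraMap ℚ_[p] K r, (mem_valRing _).2 (by rw [norm_algebraMap']; exact r.2)⟩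
  have hj : Continuous j :=
    ((algebraMapCLM ℚ_[p] K).continuous.comp continuous_subtype_val).subtype_mk _
  have hs' : s = j ⟨t, ht⟩ := Subtype.ext hs
  have hcont : Continuous fun r => φ (Ψ (j r) y) :=
    (hφ.isOpenEmbedding p).continuous.comp ((h.1.continuous p y).comp hj)
  rw [hs']
  have hclosed : IsClosed {r | φ (Ψ (j r) y) ∈ closure (MulAction.orbit Γ x)} :=
    isClosed_closure.preimage hcont
  have hnat (n : ℕ) : φ (Ψ (j n) y) ∈ closure (MulAction.orbit Γ x) := by
    have hn : j n = n := Subtype.ext (by simp [j])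
    rw [hn, h.apply_natCast]
    exact smul_mem_closure_orbit (⟨f ^ n, Γ.pow_mem hf n⟩ : Γ) hy
  exact PadicInt.denseRange_natCast.induction_on ⟨t, ht⟩ hclosed hnat

/-- If the velocities at `z` of flows of elements of `Γ` span `K ^ d` over `ℚ_p`, then the orbit
closure of `φ z` is a neighbourhood of `φ z`. -/
theorem closure_orbit_mem_nhds_of_span_velocity [FiniteDimensional ℚ_[p] K]
    {Γ : Subgroup (A ≃ₐ[valRing K] A)} (hφ : IsPolydisk φ) (z : Fin d → valRing K)
    (hspan : Submodule.span ℚ_[p]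
      {X | ∃ f ∈ Γ, ∃ Ψ, IsFlowOf φ Ψ f ∧ HasVelocity p Ψ z X} = ⊤) :
    closure (MulAction.orbit Γ (φ z)) ∈ 𝓝 (φ z) := by
  obtain ⟨T, hT, hTspan⟩ := (Submodule.fg_span_iff_fg_span_finset_subset _).1
    (hspan ▸ Module.Finite.fg_top (R := ℚ_[p]) (M := Fin d → K))
  choose f hf Ψ hΨ hX using fun i : T => hT i.2
  have h0 (i : T) : Ψ i 0 z = z := (hΨ i).apply_zero hφ z
  have hnhds := map_compFlow_nhds p h0 hX (by simpa [← hTspan] using hspan)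
  have hmem (l : List T) (t : T → ℚ_[p]) (ht : ‖t‖ ≤ 1) : ∃ y, toVec y = compFlow p Ψ z l t ∧
      φ y ∈ closure (MulAction.orbit Γ (φ z)) := by
    induction l with
    | nil => exact ⟨z, rfl, subset_closure (MulAction.mem_orbit_self _)⟩
    | cons i l ih =>
      obtain ⟨y, hy, hyc⟩ := ih
      have hti : ‖t i‖ ≤ 1 := (norm_le_pi_norm t i).trans ht
      let s : valRing K := ⟨algebraMap ℚ_[p] K (t i),
        (mem_valRing _).2 (by rwa [norm_algebraMap'])⟩
      refine ⟨Ψ i s y, ?_, (hΨ i).apply_mem_closure_orbit p hφ (hf i) hyc hti rfl⟩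
      rw [compFlow, ← hy]
      exact (flowExt_apply (Ψ i) s y).symm
  have himage := image_mem_map (m := compFlow p Ψ z Finset.univ.toList)
    (eventually_norm_le_one (w := (0 : T → ℚ_[p])) (by simp))
  rw [hnhds] at himage
  refine mem_of_superset ((hφ.isOpenEmbedding p).isOpenMap.image_mem_nhds
    (isEmbedding_toVec.continuous.continuousAt himage)) ?_
  rintro _ ⟨y, ⟨t, ht, hty⟩, rfl⟩
  obtain ⟨y', hy', hmem'⟩ := hmem Finset.univ.toList t ht
  rwa [← toVec_injective (hy'.trans hty)]

end Polydisks

section TangentSpaces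

variable {K : Type*} [NormedField K] [IsUltrametricDist K]
variable {A : Type*} [CommRing A] [Algebra (valRing K) A]
variable {d : ℕ} {φ : (Fin d → valRing K) → Points K A}
variable (p : ℕ) [Fact p.Prime] [NormedAlgebra ℚ_[p] K]

/-- The derivative of the flow along a regular function, computed along the times `p ^ k`: in this
form it only involves the iterates `f ^ (p ^ k)`. -/
theorem IsFlowOf.tendsto_of_hasVelocity {Ψ : valRing K → (Fin d → valRing K) → (Fin d → valRing K)}
    {f : A ≃ₐ[valRing K] A} (hφ : IsPolydisk φ) (h : IsFlowOf φ Ψ f) {z : Fin d → valRing K}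
    {X : Fin d → K} (hX : HasVelocity p Ψ z X) {a : A} {D : (Fin d → K) →L[ℚ_[p]] K}
    (hD : HasStrictFDerivAt (Function.extend toVec (fun y => ((φ y).eval a : K)) 0) D (toVec z)) :
    Tendsto (fun k : ℕ => ((p : K) ^ k)⁻¹ *
      (((f ^ p ^ k • φ z).eval a : K) - ((φ z).eval a : K))) atTop (𝓝 (D X)) := by
  have hp0 : (p : ℚ_[p]) ≠ 0 := Nat.cast_ne_zero.2 (Fact.out : p.Prime).ne_zero
  have h00 : flowExt Ψ (algebraMap ℚ_[p] K 0, toVec z) = toVec z := by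
    rw [map_zero, ← ZeroMemClass.coe_zero (valRing K), flowExt_apply, h.apply_zero hφ]
  have hcurve : HasDerivAt (fun s : ℚ_[p] => Function.extend toVec (fun y => ((φ y).eval a : K)) 0
      (flowExt Ψ (algebraMap ℚ_[p] K s, toVec z))) (D X) 0 := by
    rw [← h00] at hD
    rw [HasVelocity] at hX
    have h1 := hX.hasFDerivAt.comp (f := fun s : ℚ_[p] => (s, toVec z)) 0
      (hasFDerivAt_prodMk_left (0 : ℚ_[p]) (toVec z))
    have h2 := HasFDerivAt.comp (f := fun s : ℚ_[p] => flowExt Ψ (algebraMap ℚ_[p] K s, toVec z))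
      0 hD.hasFDerivAt h1
    exact h2.hasDerivAt.congr_deriv (by simp)
  have hpk : Tendsto (fun k : ℕ => (p : ℚ_[p]) ^ k) atTop (𝓝[≠] 0) :=
    tendsto_nhdsWithin_iff.2 ⟨tendsto_pow_atTop_nhds_zero_of_norm_lt_one Padic.norm_p_lt_one,
      .of_forall fun k => pow_ne_zero k hp0⟩
  refine (hcurve.tendsto_slope.comp hpk).congr fun k => ?_
  have hk : algebraMap ℚ_[p] K ((p : ℚ_[p]) ^ k) = (((p ^ k : ℕ) : valRing K) : K) := by simp
  rw [Function.comp_apply, slope, vsub_eq_sub, h00, hk, flowExt_apply, sub_zero,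
    toVec_injective.extend_apply, toVec_injective.extend_apply, h.apply_natCast,
    Algebra.smul_def]
  simp

end TangentSpaces

/-! ### The tangent space to the action -/

section TangentSpaces

variable {K : Type*} [NormedField K] [IsUltrametricDist K]
variable {A : Type*} [CommRing A] [Algebra (valRing K) A]
variable (p : ℕ) [Fact p.Prime] [NormedAlgebra ℚ_[p] K]

/-- A flow vector of `f` at `x` can be computed along the times `N p ^ k`, hence is determined by the
iterates of `f`: it does not depend on the polydisk nor on the flow. -/
theorem IsFlowVector.tendsto {d : ℕ} {φ : (Fin d → valRing K) → Points K A} (hφ : IsPolydisk φ)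
    {f : A ≃ₐ[valRing K] A} {x : Points K A} {v : tangentSpace x} (h : IsFlowVector φ f x v)
    {N : ℕ} (hN : N ≠ 0) (a : A) :
    Tendsto (fun k : ℕ => ((p : K) ^ k)⁻¹ *
      ((((f ^ N) ^ p ^ k • x).eval a : K) - (x.eval a : K))) atTop (𝓝 (N * v.1 a)) := by
  obtain ⟨Ψ, hΨ, z, rfl, hv⟩ := h
  have : CharZero K := charZero_of_injective_algebraMap (algebraMap ℚ_[p] K).injective
  have hp0 : (p : K) ≠ 0 := Nat.cast_ne_zero.2 (Fact.out : p.Prime).ne_zero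
  have hN0 : (N : K) ≠ 0 := Nat.cast_ne_zero.2 hN
  have hp1 : ‖(p : K)‖ < 1 := by
    have : ‖algebraMap ℚ_[p] K p‖ < 1 := by rw [norm_algebraMap']; exact Padic.norm_p_lt_one
    simpa using this
  have hlim : Tendsto (fun k : ℕ => ((N * p ^ k : ℕ) : valRing K)) atTop (𝓝[≠] 0) := by
    refine tendsto_nhdsWithin_iff.2 ⟨?_, .of_forall fun k h0 => ?_⟩
    · refine IsEmbedding.subtypeVal.tendsto_nhds_iff.2 ?_
      simpa [Function.comp_def] using
        (tendsto_pow_atTop_nhds_zero_of_norm_lt_one hp1).const_mul (N : K)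
    · have : (((N * p ^ k : ℕ) : valRing K) : K) = 0 := by rw [h0]; rfl
      simp [hN0, hp0] at this
  refine (((hv a).comp hlim).const_mul (N : K)).congr fun k => ?_
  rw [Function.comp_apply, hΨ.apply_natCast, hΨ.apply_zero hφ, pow_mul]
  push_cast
  field_simp

/-- Whatever the good pairs used to define it, `L_Γ(x)` is contained in the image under the
derivative of a given good chart `φ` of the span of the velocities in that chart. -/
theorem exists_map_tangentToAction_le [FiniteDimensional ℚ_[p] K]
    {Γ Γ₀ : Subgroup (A ≃ₐ[valRing K] A)}
    {d : ℕ} {φ : (Fin d → valRing K) → Points K A} (h : IsGood Γ Γ₀ φ) (z : Fin d → valRing K) :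
    ∃ D : (Fin d → K) →ₗ[ℚ_[p]] (A → K),
      (tangentToAction p Γ (φ z)).map ((tangentSpace (φ z)).subtype.restrictScalars ℚ_[p]) ≤
        (Submodule.span ℚ_[p]
          {X | ∃ f ∈ Γ, ∃ Ψ, IsFlowOf φ Ψ f ∧ HasVelocity p Ψ z X}).map D := by
  have : CompleteSpace K := FiniteDimensional.complete ℚ_[p] K
  have : CharZero K := charZero_of_injective_algebraMap (algebraMap ℚ_[p] K).injective
  choose D hD using fun a : A => (h.isPolydisk.analytic a).exists_hasStrictFDerivAt p
    (G := Function.extend toVec _ 0) (toVec_injective.extend_apply _ _) z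
  refine ⟨LinearMap.pi fun a => (D a).toLinearMap, ?_⟩
  rw [Submodule.map_le_iff_le_comap]
  refine iSup_le fun Γ₁ => iSup_le fun φ₁ => iSup_le fun ⟨h₁, _⟩ => Submodule.span_le.2 ?_
  rintro v ⟨f, hf, hv⟩
  have hindex : (Γ₀.subgroupOf Γ).index ≠ 0 := h.finiteIndex.index_ne_zero
  obtain ⟨N, hN, -, hfN⟩ := Subgroup.exists_pow_mem_of_index_ne_zero hindex ⟨f, h₁.le hf⟩
  have hfN : f ^ N ∈ Γ₀ := hfN
  obtain ⟨Ψ, hΨ⟩ := h.exists_flow _ hfN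
  obtain ⟨X, hX⟩ := hΨ.1.exists_hasVelocity p (hΨ.apply_zero h.isPolydisk) z
  have hXv (a : A) : D a X = N * v.1 a :=
    tendsto_nhds_unique (hΨ.tendsto_of_hasVelocity p h.isPolydisk hX (hD a))
      (hv.tendsto p h₁.isPolydisk hN.ne' a)
  refine ⟨(N : ℚ_[p])⁻¹ • X, Submodule.smul_mem _ _
    (Submodule.subset_span ⟨_, h.le hfN, Ψ, hΨ, hX⟩), funext fun a => ?_⟩
  have hN0 : (N : K) ≠ 0 := Nat.cast_ne_zero.2 hN.ne'
  change D a ((N : ℚ_[p])⁻¹ • X) = v.1 a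
  rw [map_smul, hXv, Algebra.smul_def]
  simp [hN0]

/-- If `L_Γ(x)` has the largest possible dimension, then the orbit closure of `x` is a neighbourhood
of `x`. -/
theorem closure_orbit_mem_nhds [FiniteDimensional ℚ_[p] K] [Algebra.FiniteType (valRing K) A]
    {Γ : Subgroup (A ≃ₐ[valRing K] A)} {x : Points K A}
    (hs : flowDim p Γ x = Module.finrank ℚ_[p] K * dim K A) :
    closure (MulAction.orbit Γ x) ∈ 𝓝 x := by
  rcases Nat.eq_zero_or_pos (dim K A) with h0 | hpos
  · have := finite_points_of_dim_eq_zero K A h0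
    exact mem_of_superset (mem_nhds_discrete.2 rfl : {x} ∈ 𝓝 x)
      (Set.singleton_subset_iff.2 (subset_closure (MulAction.mem_orbit_self x)))
  -- A good chart exists, as otherwise `L_Γ(x)` would be the supremum of an empty family.
  obtain ⟨Γ₀, φ, h, z, rfl⟩ : ∃ (Γ₀ : Subgroup (A ≃ₐ[valRing K] A))
      (φ : (Fin (dim K A) → valRing K) → Points K A), IsGood Γ Γ₀ φ ∧ x ∈ Set.range φ := by
    by_contra! hne
    have hbot : tangentToAction p Γ x = ⊥ := by
      simp only [tangentToAction, iSup_eq_bot]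
      exact fun Γ₀ φ h => absurd h.2 (hne Γ₀ φ h.1)
    have hdim : 0 < Module.finrank ℚ_[p] K * dim K A := Nat.mul_pos Module.finrank_pos hpos
    rw [← hs, flowDim, hbot, finrank_bot] at hdim
    exact lt_irrefl _ hdim
  refine closure_orbit_mem_nhds_of_span_velocity p h.isPolydisk z ?_
  obtain ⟨D, hD⟩ := exists_map_tangentToAction_le p h z
  refine Submodule.eq_top_of_finrank_eq (le_antisymm (Submodule.finrank_le _) ?_)
  have hinj : Function.Injective ((tangentSpace (φ z)).subtype.restrictScalars ℚ_[p]) :=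
    Subtype.val_injective
  calc Module.finrank ℚ_[p] (Fin (dim K A) → K) = flowDim p Γ (φ z) := by
        rw [hs, Module.finrank_pi_fintype, Finset.sum_const, Finset.card_univ, Fintype.card_fin,
          smul_eq_mul, mul_comm]
    _ = _ := (Submodule.equivMapOfInjective _ hinj (tangentToAction p Γ (φ z))).finrank_eq
    _ ≤ _ := Submodule.finrank_mono hD
    _ ≤ _ := Submodule.finrank_map_le _ _

end TangentSpaces

end PadicOrbit

theorem theoremB (p : ℕ) [Fact p.Prime]
    (K : Type*) [NormedField K] [IsUltrametricDist K] [NormedAlgebra ℚ_[p] K]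
    [FiniteDimensional ℚ_[p] K]
    (A : Type*) [CommRing A] [Algebra (PadicOrbit.valRing K) A]
    [Algebra.FiniteType (PadicOrbit.valRing K) A]
    [Algebra.Smooth K (K ⊗[PadicOrbit.valRing K] A)]
    (Γ : Subgroup (A ≃ₐ[PadicOrbit.valRing K] A))
    (B : Set (PadicOrbit.Points K A)) (hB : IsCompact B)
    (hΓB : ∀ f ∈ Γ, ∀ x ∈ B, f • x ∈ B)
    (hs : ∀ x ∈ B, PadicOrbit.flowDim p Γ x = Module.finrank ℚ_[p] K * PadicOrbit.dim K A) :
    {C | ∃ x ∈ B, C = closure (MulAction.orbit Γ x)}.Finite ∧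
      {C | ∃ x ∈ B, C = closure (MulAction.orbit Γ x)}.PairwiseDisjoint id ∧
      ⋃₀ {C | ∃ x ∈ B, C = closure (MulAction.orbit Γ x)} = B ∧
      ∀ x ∈ B, IsCompact (closure (MulAction.orbit Γ x)) ∧
        IsOpen (closure (MulAction.orbit Γ x)) :=
  PadicOrbit.closure_orbit_partition hB (fun g => hΓB g g.2)
    fun x hx => PadicOrbit.closure_orbit_mem_nhds p (hs x hx)
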